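/- Let $K$ be a number field with ring of integers $\mathcal O$, and let $\mathbf G$ be a unipotent group scheme over $\mathcal O$, i.e. an affine group scheme of finite type over $\mathcal O$ whose fibre over every point $x$ of $\operatorname{Spec}\mathcal O$ is a unipotent algebraic group over the residue field $\kappa(x)$ (isomorphic to a closed subgroup scheme of the group $\mathrm U_n$ of upper unitriangular matrices over $\kappa(x)$ for some $n$). For a finite group $G$ let $r_n(G)$ be the number of isomorphism classes of $n$-dimensional irreducible complex representations of $G$, let $c_n(G)$ be the number of conjugacy classes of $G$ of cardinality $n$, and put $$\zeta^{\mathrm{irr}}_G(s)=\sum_{n=1}^\infty r_n(G)n^{-s},\qquad \zeta^{\mathrm{cc}}_G(s)=\sum_{n=1}^\infty c_n(G)n^{-s}.$$ For $\ast\in\{\mathrm{irr},\mathrm{cc}\}$ define the global bivariate zeta function $$\mathcal Z^\ast_{\mathbf G(\mathcal O)}(s_1,s_2)=\sum_{(0)\ne I\trianglelefteq\mathcal O}\zeta^\ast_{\mathbf G(\mathcal O/I)}(s_1)\,|\mathcal O:I|^{-s_2},$$ and, for each nonzero prime ideal $\mathfrak p$ of $\mathcal O$, with $\mathfrak o=\mathcal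 O_{\mathfrak p}$ the completion of $\mathcal O$ at $\mathfrak p$ and $\mathfrak p$ also denoting the maximal ideal of $\mathfrak o$, the local factor $$\mathcal Z^\ast_{\mathbf G(\mathcal O_{\mathfrak p})}(s_1,s_2)=\sum_{N=0}^\infty\zeta^\ast_{\mathbf G(\mathfrak o/\mathfrak p^N)}(s_1)\,|\mathfrak o:\mathfrak p|^{-Ns_2}.$$ Proposition. For each $\ast\in\{\mathrm{irr},\mathrm{cc}\}$ there are real numbers $\alpha_1,\alpha_2$ such that for all $s_1,s_2\in\mathbb C$ with $\operatorname{Re}(s_1)>\alpha_1$ and $\operatorname{Re}(s_2)>\alpha_2$ the series defining $\mathcal Z^\ast_{\mathbf G(\mathcal O)}(s_1,s_2)$ and all the series defining $\mathcal Z^\ast_{\mathbf G(\mathcal O_{\mathfrak p})}(s_1,s_2)$ converge absolutely (as double series over $I$ and $n$, respectively over $N$ and $n$), and $$\mathcal Z^\ast_{\mathbf G(\mathcal O)}(s_1,s_2)=\prod_{\mathfrak p\in\operatorname{Spec}(\mathcal O)\setminus\{(0)\}}\mathcal Z^\ast_{\mathbf G(\mathcal O_{\mathfrak p})}(s_1,s_2),$$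 where the product converges unconditionally (the finite partial products converge to the left-hand side along the directed set of finite sets of nonzero primes). -/

import Mathlib

open scoped TensorProduct NumberField

noncomputable section

/-- Two `n`-dimensional irreducible complex representations, realised on `ℂⁿ`, are identified
when they are isomorphic as representations. -/
def irrepSetoid (G : Type*) [Group G] (n : ℕ) :
    Setoid {ρ : Representation ℂ G (Fin n → ℂ) // ρ.IsIrreducible} where
  r ρ σ := Nonempty (ρ.1.Equiv σ.1)
  iseqv :=
    { refl := fun ρ => ⟨Representation.Equiv.refl ρ.1⟩
      symm := fun ⟨e⟩ => ⟨e.symm⟩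
      trans := fun ⟨e⟩ ⟨f⟩ => ⟨e.trans f⟩ }

/-- `r_n(G)`: the number of isomorphism classes of `n`-dimensional irreducible complex
representations of `G`. (Every `n`-dimensional representation is isomorphic to one on `ℂⁿ`.) -/
def irrCount (G : Type*) [Group G] (n : ℕ) : ℕ :=
  Nat.card (Quotient (irrepSetoid G n))

/-- `c_n(G)`: the number of conjugacy classes of `G` of cardinality `n`. -/
def ccCount (G : Type*) [Group G] (n : ℕ) : ℕ :=
  Nat.card {C : ConjClasses G // Nat.card C.carrier = n}

/-- The label `∗ ∈ {irr, cc}`. -/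
inductive ZetaKind
  | irr
  | cc

/-- `r_n(G)` or `c_n(G)`, according to the label. -/
def ZetaKind.count (k : ZetaKind) (G : Type*) [Group G] (n : ℕ) : ℕ :=
  match k with
  | .irr => irrCount G n
  | .cc => ccCount G n

/-- The zeta function `ζ^∗_G(s) = ∑_{n ≥ 1} (r_n(G) or c_n(G)) n^{-s}` of a finite group `G`. -/
def groupZeta (k : ZetaKind) (G : Type*) [Group G] (s : ℂ) : ℂ :=
  ∑' n : ℕ+, (k.count G n : ℂ) * (n : ℂ) ^ (-s)

/-- The group `𝐆(S)` of `S`-points of the affine group scheme `𝐆 = Spec A` over `R`, where `A` is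
a commutative Hopf algebra over `R`: the `R`-algebra homomorphisms `A → S` under convolution. -/
abbrev GroupPoints (R A S : Type*) [CommRing R] [CommRing A] [HopfAlgebra R A]
    [CommRing S] [Algebra R S] : Type _ :=
  WithConv (A →ₐ[R] S)

/-- The group structure on `𝐆(S)`: multiplication is convolution (Mathlib's monoid structure), and
inversion is composition with the antipode. -/
instance groupPointsGroup (R A S : Type*) [CommRing R] [CommRing A] [HopfAlgebra R A]
    [CommRing S] [Algebra R S] : Group (WithConv (A →ₐ[R] S)) where
  inv f := WithConv.toConv (f.ofConv.comp (HopfAlgebra.antipodeAlgHom R A))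
  inv_mul_cancel f := by
    have h := AlgHom.comp_convMul_distrib f.ofConv
      (WithConv.toConv (HopfAlgebra.antipodeAlgHom R A)) (WithConv.toConv (AlgHom.id R A))
    rw [AlgHom.antipode_id_cancel] at h
    apply WithConv.ofConv_injective
    refine Eq.trans h.symm ?_
    apply AlgHom.ext
    intro a
    exact f.ofConv.commutes _

/-- The affine group scheme `Spec B` over the field `k` is a unipotent algebraic group: it is
isomorphic to a closed subgroup scheme of the group `U_n` of upper unitriangular matrices for
some `n`. In terms of `B`: there is an upper unitriangular matrix `b` over `B`, the image of the
universal one under a surjective Hopf algebra homomorphism `k[U_n] → B`. -/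
def IsUnipotentAlgebraicGroup (k B : Type*) [Field k] [CommRing B] [HopfAlgebra k B] : Prop :=
  ∃ (n : ℕ) (b : Matrix (Fin n) (Fin n) B),
    (∀ i, b i i = 1) ∧ (∀ i j, j < i → b i j = 0) ∧
    (∀ i j, Coalgebra.counit (R := k) (b i j) = if i = j then 1 else 0) ∧
    (∀ i j, Coalgebra.comul (R := k) (b i j) = ∑ l, b i l ⊗ₜ[k] b l j) ∧
    Algebra.adjoin k (Set.range fun ij : Fin n × Fin n => b ij.1 ij.2) = ⊤

/-- The affine group scheme `Spec A` over `R` is a unipotent group scheme: it is of finite type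
over `R`, and its fibre over every point of `Spec R` is a unipotent algebraic group over the
residue field of that point. -/
structure IsUnipotentGroupScheme (R A : Type*) [CommRing R] [CommRing A] [HopfAlgebra R A] :
    Prop where
  finiteType : Algebra.FiniteType R A
  unipotent_fibre : ∀ p : PrimeSpectrum R,
    IsUnipotentAlgebraicGroup p.asIdeal.ResidueField (p.asIdeal.ResidueField ⊗[R] A)

section Bivariate

variable (K : Type*) [Field K] [NumberField K]
variable (A : Type*) [CommRing A] [HopfAlgebra (𝓞 K) A]

/-- `𝒵^∗_{𝐆(𝓞)}(s₁, s₂) = ∑_{(0) ≠ I ⊴ 𝓞} ζ^∗_{𝐆(𝓞/I)}(s₁) |𝓞 : I|^{-s₂}` for `𝐆 = Spec A`. -/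
def globalBivariateZeta (k : ZetaKind) (s₁ s₂ : ℂ) : ℂ :=
  ∑' I : {I : Ideal (𝓞 K) // I ≠ ⊥},
    groupZeta k (GroupPoints (𝓞 K) A (𝓞 K ⧸ I.1)) s₁ * (Nat.card (𝓞 K ⧸ I.1) : ℂ) ^ (-s₂)

variable (v : IsDedekindDomain.HeightOneSpectrum (𝓞 K))

/-- The `N`-th principal congruence quotient `𝔬/𝔭^N` of the completion `𝔬` of `𝓞` at `v`, where
`𝔭` is the maximal ideal of `𝔬`. -/
abbrev CompletionQuotient (N : ℕ) : Type _ :=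
  v.adicCompletionIntegers K ⧸ IsLocalRing.maximalIdeal (v.adicCompletionIntegers K) ^ N

/-- The index `|𝔬 : 𝔭|`. -/
def completionIndex : ℕ :=
  Nat.card
    (v.adicCompletionIntegers K ⧸ IsLocalRing.maximalIdeal (v.adicCompletionIntegers K))

/-- `𝒵^∗_{𝐆(𝔬)}(s₁, s₂) = ∑_{N ≥ 0} ζ^∗_{𝐆(𝔬/𝔭^N)}(s₁) |𝔬 : 𝔭|^{-N s₂}` for `𝐆 = Spec A`, where
`𝔬` is the completion of `𝓞` at `v`. -/
def localBivariateZeta (k : ZetaKind) (s₁ s₂ : ℂ) : ℂ :=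
  ∑' N : ℕ, groupZeta k (GroupPoints (𝓞 K) A (CompletionQuotient K v N)) s₁ *
    (completionIndex K v : ℂ) ^ (-(N * s₂))

end Bivariate

end

/-! Write `f(I)` for the term of the global series at `I`. The theorem is the Euler product of the
multiplicative function `f` on nonzero ideals, together with a bound giving absolute convergence.

Multiplicativity: for coprime `I`, `J` the Chinese remainder theorem and the functor of points give
`𝐆(𝓞/IJ) ≅ 𝐆(𝓞/I) × 𝐆(𝓞/J)`, and `ζ^∗` takes products of finite groups to products
(`groupZeta_prod`). For conjugacy classes this is componentwise conjugacy; for characters it says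
that the irreducible representations of `G × H` are exactly the external tensor products
(`exists_equiv_extTensor`).

Convergence: `d` algebra generators of `A` embed `𝐆(S)` in `S^d`. For `Re s₁ > 0` the absolute
series of `ζ^∗` is at most the number of classes, hence at most `|𝐆(𝓞/I)| ≤ |𝓞/I|^d`, and the global
series is dominated by a Dedekind zeta series (`summable_bivariate`).

Unique factorisation of ideals then yields the product (`hasProd_tsum_pow`), and `𝓞/𝔭^N ≅ 𝔬/𝔭^N`
identifies its factors with the local zeta functions. -/

namespace Representation

/-! ### Irreducibility from a one-dimensional endomorphism algebra -/

section Irreducibility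

variable {G V : Type*} [Group G] [Finite G] [AddCommGroup V] [Module ℂ V]

/-- A complex representation of a finite group whose endomorphism algebra is one-dimensional is
irreducible. -/
theorem isIrreducible_of_finrank_end_eq_one (ρ : Representation ℂ G V)
    (h : Module.finrank ℂ (IntertwiningMap ρ ρ) = 1) : IsIrreducible ρ := by
  have hid : IntertwiningMap.id ρ ≠ 0 := by
    intro h0
    have : Subsingleton (IntertwiningMap ρ ρ) := by
      refine subsingleton_of_forall_eq 0 fun f => ?_
      have : f = f.comp (IntertwiningMap.id ρ) := by ext; simp
      rw [this, h0]
      ext; simp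
    rw [Module.finrank_zero_of_subsingleton] at h
    exact zero_ne_one h
  have hscalar := (finrank_eq_one_iff_of_nonzero' _ hid).1 h
  have hV : ∃ v : V, v ≠ 0 := by
    by_contra! hV
    exact hid (by ext v; simpa using hV v)
  obtain ⟨v, hv⟩ := hV
  have hbt : (⊥ : Subrepresentation ρ) ≠ ⊤ := by
    intro hbt
    have : v ∈ (⊥ : Subrepresentation ρ) := by
      rw [hbt]
      exact Submodule.mem_top
    exact hv ((Submodule.mem_bot ℂ).1 this)
  refine { exists_pair_ne := ⟨⊥, ⊤, hbt⟩, eq_bot_or_eq_top := fun U => ?_ }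
  -- By Maschke, `U` has an invariant complement. The projection onto `U` along it commutes with
  -- `G`, so it is a scalar `c`; then `U` is zero if `c = 0` and everything otherwise.
  obtain ⟨U', hU⟩ := exists_isCompl U
  have hU' : IsCompl U.toSubmodule U'.toSubmodule := by
    refine ⟨disjoint_iff.2 ?_, codisjoint_iff.2 ?_⟩
    · have := congrArg Subrepresentation.toSubmodule hU.inf_eq_bot
      rwa [Subrepresentation.toSubmodule_inf] at this
    · have := congrArg Subrepresentation.toSubmodule hU.sup_eq_top
      rwa [Subrepresentation.toSubmodule_sup] at this
  let π := U.toSubmodule.projection U'.toSubmodule hU'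
  have key : ∀ g, ∀ v, π (ρ g v) = ρ g (π v) := by
    intro g v
    obtain ⟨a, ha, b, hb, rfl⟩ : ∃ a ∈ U.toSubmodule, ∃ b ∈ U'.toSubmodule, a + b = v :=
      Submodule.mem_sup.1 (hU'.sup_eq_top ▸ Submodule.mem_top)
    have h1 := U.apply_mem_toSubmodule g ha
    have h2 := U'.apply_mem_toSubmodule g hb
    simp only [map_add, π]
    rw [(Submodule.projection_apply_eq_zero_iff hU').2 hb,
      (Submodule.projection_apply_eq_zero_iff hU').2 h2,
      Submodule.projection_apply_of_mem_left hU' ha,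
      Submodule.projection_apply_of_mem_left hU' h1]
    simp
  obtain ⟨c, hc⟩ := hscalar ⟨π, fun g => by ext v; exact key g v⟩
  have hc' : ∀ v, U.toSubmodule.projection U'.toSubmodule hU' v = c • v := fun v => by
    have := congrArg (fun f : IntertwiningMap ρ ρ => f v) hc
    exact this.symm
  by_cases hc0 : c = 0
  · left
    apply Subrepresentation.toSubmodule_injective
    refine (Submodule.eq_bot_iff _).2 fun u hu => ?_
    rw [← Submodule.projection_apply_of_mem_left hU' hu, hc', hc0, zero_smul]
  · right
    apply Subrepresentation.toSubmodule_injective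
    refine (Submodule.eq_top_iff'.2 fun u => ?_)
    have : c • u ∈ U.toSubmodule := by
      rw [← hc']
      exact Submodule.projection_apply_mem hU' u
    simpa [hc0] using U.toSubmodule.smul_mem c⁻¹ this

end Irreducibility

/-! ### Irreducibility and isomorphism read off from characters -/

section Character

variable {G V W : Type*} [Group G] [AddCommGroup V] [Module ℂ V] [FiniteDimensional ℂ V]
  [AddCommGroup W] [Module ℂ W] [FiniteDimensional ℂ W]

open scoped Classical in
theorem char_orthonormal_complex [Fintype G] (ρ : Representation ℂ G V) (σ : Representation ℂ G W)
    [IsIrreducible ρ] [IsIrreducible σ] :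
    (Nat.card G : ℂ)⁻¹ * ∑ g : G, ρ.character g * σ.character g⁻¹ =
      if Nonempty (Equiv σ ρ) then 1 else 0 := by
  have : Invertible (Nat.card G : ℂ) := invertibleOfNonzero (by simp [Fintype.card_ne_zero])
  exact char_orthonormal ρ σ

/-- A complex representation of a finite group whose character has norm one is irreducible. -/
theorem isIrreducible_of_char [Fintype G] (ρ : Representation ℂ G V)
    (h : (Nat.card G : ℂ)⁻¹ * ∑ g : G, ρ.character g * ρ.character g⁻¹ = 1) :
    IsIrreducible ρ := by
  have : Invertible (Nat.card G : ℂ) := invertibleOfNonzero (by simp [Fintype.card_ne_zero])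
  apply isIrreducible_of_finrank_end_eq_one
  rw [card_inv_mul_sum_char_mul_char_eq_finrank] at h
  exact_mod_cast h

theorem char_norm_eq_one [Fintype G] (ρ : Representation ℂ G V) [IsIrreducible ρ] :
    (Nat.card G : ℂ)⁻¹ * ∑ g : G, ρ.character g * ρ.character g⁻¹ = 1 := by
  classical
  rw [char_orthonormal_complex, if_pos ⟨Equiv.refl ρ⟩]

/-- Irreducible complex representations of a finite group with equal characters are isomorphic. -/
theorem nonempty_equiv_of_character_eq [Finite G] (ρ : Representation ℂ G V)
    (σ : Representation ℂ G W) [IsIrreducible ρ] [IsIrreducible σ]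
    (h : ρ.character = σ.character) : Nonempty (Equiv ρ σ) := by
  classical
  have := Fintype.ofFinite G
  have h1 := char_orthonormal_complex σ ρ
  rw [h, char_norm_eq_one] at h1
  by_contra hne
  simp [hne] at h1

/-- The norm-one criterion involves only the character. This is how irreducibility passes along
isomorphisms. -/
theorem isIrreducible_of_character_eq [Finite G] (ρ : Representation ℂ G V)
    (σ : Representation ℂ G W) [IsIrreducible ρ]
    (h : ρ.character = σ.character) : IsIrreducible σ := by
  have := Fintype.ofFinite G
  apply isIrreducible_of_char
  rw [← h, char_norm_eq_one]

end Character

/-! ### Coordinates and irreducible subrepresentations -/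

section Transport

variable {G V : Type*} [Group G] [AddCommGroup V] [Module ℂ V] [FiniteDimensional ℂ V]

/-- Counting is done with representations on `ℂⁿ`, so subrepresentations and tensor products must be
moved there. -/
theorem exists_equiv_fin (ρ : Representation ℂ G V) :
    ∃ σ : Representation ℂ G (Fin (Module.finrank ℂ V) → ℂ), Nonempty (Equiv σ ρ) := by
  let e := (Module.finBasis ℂ V).equivFun
  let σ : Representation ℂ G (Fin (Module.finrank ℂ V) → ℂ) :=
    { toFun := fun g => e.toLinearMap ∘ₗ ρ g ∘ₗ e.symm.toLinearMap
      map_one' := by ext; simp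
      map_mul' := fun g h => by ext; simp }
  exact ⟨σ, ⟨Equiv.mk e.symm fun g => by ext; simp [σ]⟩⟩

/-- Every nonzero finite-dimensional representation contains an irreducible one. -/
theorem exists_isIrreducible_subrepresentation [Nontrivial V] (ρ : Representation ℂ G V) :
    ∃ U : Subrepresentation ρ, IsIrreducible U.toRepresentation := by
  have : ∃ U : Subrepresentation ρ, U ≠ ⊥ := by
    refine ⟨⊤, fun h => ?_⟩
    obtain ⟨v, hv⟩ := exists_ne (0 : V)
    have : v ∈ (⊥ : Subrepresentation ρ) := by
      rw [← h]
      exact Submodule.mem_top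
    exact hv ((Submodule.mem_bot ℂ).1 this)
  -- A nonzero subrepresentation of least dimension is irreducible.
  obtain ⟨U, hU, hmin⟩ := WellFounded.has_min
    (InvImage.wf (fun U : Subrepresentation ρ => Module.finrank ℂ U.toSubmodule) wellFounded_lt)
    {U | U ≠ ⊥} this
  refine ⟨U, ?_⟩
  have hU0 : U.toSubmodule ≠ ⊥ := fun h => hU (Subrepresentation.toSubmodule_injective h)
  obtain ⟨u, hu, hu0⟩ := U.toSubmodule.exists_mem_ne_zero_of_ne_bot hU0
  refine { exists_pair_ne := ⟨⊥, ⊤, fun h => ?_⟩, eq_bot_or_eq_top := fun W => ?_ }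
  · have : (⟨u, hu⟩ : U.toSubmodule) ∈ (⊥ : Subrepresentation U.toRepresentation) := by
      rw [h]
      exact Submodule.mem_top
    have := (Submodule.mem_bot ℂ).1 this
    exact hu0 (congrArg Subtype.val this)
  · by_cases hW : W = ⊥
    · exact Or.inl hW
    right
    let W' : Subrepresentation ρ :=
      { toSubmodule := W.toSubmodule.map U.toSubmodule.subtype
        apply_mem_toSubmodule := by
          rintro g _ ⟨w, hw, rfl⟩
          exact ⟨U.toRepresentation g w, W.apply_mem_toSubmodule g hw, rfl⟩ }
    have hW' : W' ≠ ⊥ := by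
      intro h
      have h1 : W.toSubmodule.map U.toSubmodule.subtype = ⊥ :=
        congrArg Subrepresentation.toSubmodule h
      refine hW (Subrepresentation.toSubmodule_injective
        (Submodule.map_injective_of_injective U.toSubmodule.injective_subtype ?_))
      rw [h1]
      exact Submodule.map_bot _ |>.symm
    have h1 : Module.finrank ℂ U.toSubmodule ≤ Module.finrank ℂ W'.toSubmodule :=
      not_lt.1 (hmin W' hW')
    have h2 : Module.finrank ℂ W'.toSubmodule = Module.finrank ℂ W.toSubmodule :=
      Submodule.finrank_map_subtype_eq _ _
    apply Subrepresentation.toSubmodule_injective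
    exact Submodule.eq_top_of_finrank_eq
      (le_antisymm (Submodule.finrank_le _) (h2 ▸ h1))

theorem exists_isIrreducible_intertwiningMap [Finite G] [Nontrivial V]
    (ρ : Representation ℂ G V) :
    ∃ (n : ℕ) (σ : Representation ℂ G (Fin n → ℂ)) (f : IntertwiningMap σ ρ),
      IsIrreducible σ ∧ Function.Injective f := by
  obtain ⟨U, hU⟩ := exists_isIrreducible_subrepresentation ρ
  obtain ⟨σ, ⟨e⟩⟩ := exists_equiv_fin U.toRepresentation
  let ι : IntertwiningMap U.toRepresentation ρ := ⟨U.toSubmodule.subtype, fun g => by ext; rfl⟩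
  refine ⟨_, σ, ι.comp e.toIntertwiningMap,
    isIrreducible_of_character_eq U.toRepresentation σ (char_iso e).symm, ?_⟩
  exact U.toSubmodule.injective_subtype.comp e.toLinearEquiv.injective

theorem IsIrreducible.nontrivial {W : Type*} [AddCommGroup W] [Module ℂ W]
    (ρ : Representation ℂ G W) [h : IsIrreducible ρ] :
    Nontrivial W := by
  by_contra hW
  rw [not_nontrivial_iff_subsingleton] at hW
  obtain ⟨a, b, hab⟩ := h.exists_pair_ne
  exact hab (Subrepresentation.toSubmodule_injective (Subsingleton.elim _ _))

end Transport

/-! ### Irreducible representations of a product of groups -/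

section ExternalTensor

variable {G H V W : Type*} [Group G] [Group H] [AddCommGroup V] [Module ℂ V]
  [AddCommGroup W] [Module ℂ W]

/-- The external tensor product of a representation of `G` and a representation of `H`. -/
noncomputable abbrev extTensor (ρ : Representation ℂ G V) (σ : Representation ℂ H W) :
    Representation ℂ (G × H) (V ⊗[ℂ] W) :=
  tprod (ρ.comp (MonoidHom.fst G H)) (σ.comp (MonoidHom.snd G H))

theorem character_extTensor [FiniteDimensional ℂ V] [FiniteDimensional ℂ W]
    (ρ : Representation ℂ G V) (σ : Representation ℂ H W) (x : G × H) :
    (extTensor ρ σ).character x = ρ.character x.1 * σ.character x.2 := by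
  rw [char_tensor]
  rfl

/-- The norm of the product character factors as the product of the two norms, each equal to one. -/
theorem isIrreducible_extTensor [Finite G] [Finite H] [FiniteDimensional ℂ V]
    [FiniteDimensional ℂ W] (ρ : Representation ℂ G V) (σ : Representation ℂ H W)
    [IsIrreducible ρ] [IsIrreducible σ] : IsIrreducible (extTensor ρ σ) := by
  have := Fintype.ofFinite G
  have := Fintype.ofFinite H
  apply isIrreducible_of_char
  have h1 := char_norm_eq_one ρ
  have h2 := char_norm_eq_one σ
  calc _ = ((Nat.card G : ℂ)⁻¹ * ∑ g : G, ρ.character g * ρ.character g⁻¹) *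
        ((Nat.card H : ℂ)⁻¹ * ∑ g : H, σ.character g * σ.character g⁻¹) := by
        rw [mul_mul_mul_comm, Finset.sum_mul_sum, ← Finset.sum_product', Nat.card_prod]
        push_cast
        rw [mul_inv]
        congr 1
        refine Finset.sum_congr (by simp) fun x _ => ?_
        rw [character_extTensor, character_extTensor, Prod.fst_inv, Prod.snd_inv]
        ring
    _ = 1 := by rw [h1, h2, one_mul]

/-- The action of the second factor on the intertwining maps from a representation of the first
factor. -/
noncomputable def homRep (ρ : Representation ℂ G V) (τ : Representation ℂ (G × H) W) :
    Representation ℂ H (IntertwiningMap ρ (τ.comp (MonoidHom.inl G H))) where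
  toFun h :=
    { toFun := fun f => ⟨τ (1, h) ∘ₗ f.toLinearMap, fun g => by
        ext v
        have h1 := f.isIntertwining _ _ g v
        simp only [MonoidHom.comp_apply, MonoidHom.inl_apply] at h1
        simp only [LinearMap.comp_apply, IntertwiningMap.toLinearMap_apply, h1,
          MonoidHom.comp_apply, MonoidHom.inl_apply]
        rw [← Module.End.mul_apply, ← Module.End.mul_apply, ← map_mul, ← map_mul]
        simp⟩
      map_add' := fun f g => by ext; simp
      map_smul' := fun c f => by ext; simp }
  map_one' := by
    ext f v
    change τ (1, 1) (f v) = f v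
    rw [show ((1, 1) : G × H) = 1 from rfl, map_one]
    rfl
  map_mul' a b := by
    ext f v
    change τ (1, a * b) (f v) = τ (1, a) (τ (1, b) (f v))
    rw [← Module.End.mul_apply, ← map_mul]
    simp

theorem homRep_apply (ρ : Representation ℂ G V) (τ : Representation ℂ (G × H) W) (h : H)
    (f : IntertwiningMap ρ (τ.comp (MonoidHom.inl G H))) (v : V) :
    homRep ρ τ h f v = τ (1, h) (f v) := rfl

/-- Every irreducible complex representation of a product of finite groups is an external tensor
product of irreducible representations. -/
theorem exists_equiv_extTensor [Finite G] [Finite H] [FiniteDimensional ℂ W]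
    (τ : Representation ℂ (G × H) W) [IsIrreducible τ] :
    ∃ (n m : ℕ) (ρ : Representation ℂ G (Fin n → ℂ)) (σ : Representation ℂ H (Fin m → ℂ)),
      IsIrreducible ρ ∧ IsIrreducible σ ∧ Nonempty (Equiv (extTensor ρ σ) τ) := by
  have := IsIrreducible.nontrivial τ
  -- Choose an irreducible `ρ` inside `τ` restricted to `G`, then an irreducible `σ` inside the
  -- nonzero `H`-representation `Hom_G(ρ, τ)`. Evaluation `ρ ⊗ σ → τ` is a nonzero intertwiner of
  -- irreducibles, so Schur's lemma makes it bijective.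
  obtain ⟨n, ρ, ι, hρ, hι⟩ := exists_isIrreducible_intertwiningMap (τ.comp (MonoidHom.inl G H))
  have := IsIrreducible.nontrivial ρ
  obtain ⟨u, hu⟩ := exists_ne (0 : Fin n → ℂ)
  have hι0 : ι ≠ 0 := fun h => hu (hι (by rw [h]; rfl))
  have : Nontrivial (IntertwiningMap ρ (τ.comp (MonoidHom.inl G H))) := ⟨ι, 0, hι0⟩
  obtain ⟨m, σ, e, hσ, he⟩ := exists_isIrreducible_intertwiningMap (homRep ρ τ)
  refine ⟨n, m, ρ, σ, hρ, hσ, ?_⟩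
  let ev : (Fin n → ℂ) ⊗[ℂ] (Fin m → ℂ) →ₗ[ℂ] W :=
    TensorProduct.lift (LinearMap.mk₂ ℂ (fun u f => e f u) (by simp) (by simp) (by simp)
      (by simp))
  have hev : ∀ u f, ev (u ⊗ₜ f) = e f u := fun u f => by simp [ev]
  let F : IntertwiningMap (extTensor ρ σ) τ :=
    ⟨ev, fun x => by
      obtain ⟨g, h⟩ := x
      ext u f
      change ev (ρ g _ ⊗ₜ σ h _) = τ (g, h) (ev (_ ⊗ₜ _))
      rw [hev, hev, e.isIntertwining _ _, homRep_apply, IntertwiningMap.isIntertwining]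
      change τ (1, h) (τ (g, 1) _) = _
      rw [← Module.End.mul_apply, ← map_mul]
      simp⟩
  have := isIrreducible_extTensor ρ σ
  rcases IsIrreducible.bijective_or_eq_zero F with hF | hF
  · exact ⟨IntertwiningMap.ofBijective F hF⟩
  · exfalso
    have := IsIrreducible.nontrivial σ
    obtain ⟨w, hw⟩ := exists_ne (0 : Fin m → ℂ)
    refine hw (he ?_)
    rw [map_zero]
    refine IntertwiningMap.ext (LinearMap.ext fun u => ?_)
    exact (hev u w).symm.trans (congrArg (fun F => F.toLinearMap (u ⊗ₜ[ℂ] w)) hF)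

end ExternalTensor

end Representation

/-! ### Irreducible characters of finite groups -/

open Representation

/-- The set of irreducible complex characters of a group. -/
def irrChar (G : Type*) [Group G] : Set (G → ℂ) :=
  {χ | ∃ (n : ℕ) (ρ : Representation ℂ G (Fin n → ℂ)), ρ.IsIrreducible ∧ ρ.character = χ}

section IrrChar

variable {G H : Type*} [Group G] [Group H]

theorem character_mem_irrChar [Finite G] {V : Type*} [AddCommGroup V] [Module ℂ V]
    [FiniteDimensional ℂ V] (ρ : Representation ℂ G V) [ρ.IsIrreducible] :
    ρ.character ∈ irrChar G := by
  obtain ⟨σ, ⟨e⟩⟩ := exists_equiv_fin ρ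
  exact ⟨_, σ, isIrreducible_of_character_eq ρ σ (char_iso e).symm, char_iso e⟩

/-- The degree of an irreducible character. -/
noncomputable def irrDegree (χ : irrChar G) : ℕ := χ.2.choose

theorem exists_rep_irrDegree (χ : irrChar G) :
    ∃ ρ : Representation ℂ G (Fin (irrDegree χ) → ℂ), ρ.IsIrreducible ∧ ρ.character = χ.1 :=
  χ.2.choose_spec

theorem irrChar_apply_one (χ : irrChar G) : χ.1 1 = irrDegree χ := by
  obtain ⟨ρ, -, h⟩ := exists_rep_irrDegree χ
  rw [← h, char_one]
  simp

theorem irrDegree_pos (χ : irrChar G) : 0 < irrDegree χ := by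
  obtain ⟨ρ, hρ, -⟩ := exists_rep_irrDegree χ
  rw [Nat.pos_iff_ne_zero]
  intro h0
  have : IsEmpty (Fin (irrDegree χ)) := by rw [h0]; infer_instance
  exact not_nontrivial _ (IsIrreducible.nontrivial ρ)

/-- `r_n(G)` counts the irreducible characters of degree `n`. -/
theorem irrCount_eq [Finite G] (n : ℕ) :
    irrCount G n = Nat.card {χ : irrChar G // irrDegree χ = n} := by
  let f : {ρ : Representation ℂ G (Fin n → ℂ) // ρ.IsIrreducible} →
      {χ : irrChar G // irrDegree χ = n} := fun ρ =>
    ⟨⟨ρ.1.character, n, ρ.1, ρ.2, rfl⟩, by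
      have h := irrChar_apply_one (⟨ρ.1.character, n, ρ.1, ρ.2, rfl⟩ : irrChar G)
      simp only [char_one, Module.finrank_fin_fun] at h
      exact_mod_cast h.symm⟩
  refine Nat.card_congr (Equiv.ofBijective
    (Quotient.lift f fun ρ σ ⟨e⟩ => Subtype.ext (Subtype.ext (char_iso e))) ⟨?_, ?_⟩)
  · rintro ⟨ρ⟩ ⟨σ⟩ h
    have := ρ.2
    have := σ.2
    exact Quotient.sound
      (nonempty_equiv_of_character_eq ρ.1 σ.1 (congrArg (fun x => x.1.1) h))
  · rintro ⟨χ, rfl⟩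
    obtain ⟨ρ, h1, h2⟩ := exists_rep_irrDegree χ
    exact ⟨Quotient.mk _ ⟨ρ, h1⟩, Subtype.ext (Subtype.ext h2)⟩

open scoped Classical in
theorem irrChar_orthonormal [Fintype G] (χ ψ : irrChar G) :
    (Nat.card G : ℂ)⁻¹ * ∑ g : G, χ.1 g * ψ.1 g⁻¹ = if χ = ψ then 1 else 0 := by
  obtain ⟨ρ, hρ, h1⟩ := exists_rep_irrDegree χ
  obtain ⟨σ, hσ, h2⟩ := exists_rep_irrDegree ψ
  rw [← h1, ← h2, char_orthonormal_complex]
  refine if_congr ⟨?_, ?_⟩ rfl rfl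
  · rintro ⟨e⟩
    exact Subtype.ext (by rw [← h1, ← h2, char_iso e])
  · intro h
    exact nonempty_equiv_of_character_eq σ ρ (by rw [h1, h2, h])

/-- Pairing with each irreducible character gives a dual family, by orthonormality. Independence in
`G → ℂ` supplies both finiteness and the bound by `|G|`. -/
theorem linearIndependent_irrChar [Finite G] :
    LinearIndependent ℂ (fun χ : irrChar G => χ.1) := by
  classical
  have := Fintype.ofFinite G
  let L : irrChar G → Module.Dual ℂ (G → ℂ) := fun ψ =>
    (Nat.card G : ℂ)⁻¹ • ∑ g : G, ψ.1 g⁻¹ • LinearMap.proj g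
  have hL : ∀ ψ χ : irrChar G, L ψ χ.1 = if χ = ψ then 1 else 0 := fun ψ χ => by
    rw [← irrChar_orthonormal]
    simp [L, mul_comm]
  exact LinearIndependent.of_pairwise_dual_eq_zero_one _ L
    (fun ψ χ h => (hL ψ χ).trans (if_neg h.symm)) (fun χ => (hL χ χ).trans (if_pos rfl))

instance [Finite G] : Finite (irrChar G) :=
  linearIndependent_irrChar.finite

theorem card_irrChar_le [Finite G] : Nat.card (irrChar G) ≤ Nat.card G := by
  have := Fintype.ofFinite G
  have := Fintype.ofFinite (irrChar G)
  have h := (linearIndependent_irrChar (G := G)).fintype_card_le_finrank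
  rw [Module.finrank_fintype_fun_eq_card] at h
  simpa [Nat.card_eq_fintype_card] using h

theorem comp_mem_irrChar [Finite G] (e : G ≃* H) {χ : H → ℂ} (hχ : χ ∈ irrChar H) :
    χ ∘ e ∈ irrChar G := by
  have : Finite H := Finite.of_equiv _ e.toEquiv
  have := Fintype.ofFinite G
  have := Fintype.ofFinite H
  obtain ⟨n, ρ, hρ, rfl⟩ := hχ
  refine ⟨n, ρ.comp e.toMonoidHom, ?_, rfl⟩
  apply isIrreducible_of_char
  rw [← char_norm_eq_one ρ, Nat.card_congr e.toEquiv, ← e.toEquiv.sum_comp]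
  congr 1
  refine Finset.sum_congr rfl fun g _ => ?_
  rw [show e.toEquiv g = e g from rfl, ← map_inv]
  rfl

theorem exists_irrChar_equiv [Finite G] (e : G ≃* H) :
    ∃ f : irrChar G ≃ irrChar H, ∀ χ, irrDegree (f χ) = irrDegree χ := by
  have : Finite H := Finite.of_equiv _ e.toEquiv
  refine ⟨{ toFun := fun χ => ⟨χ.1 ∘ e.symm, comp_mem_irrChar e.symm χ.2⟩
            invFun := fun χ => ⟨χ.1 ∘ e, comp_mem_irrChar e χ.2⟩
            left_inv := fun χ => by ext; simp
            right_inv := fun χ => by ext; simp }, fun χ => ?_⟩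
  have h1 := irrChar_apply_one χ
  have h2 := irrChar_apply_one (⟨χ.1 ∘ e.symm, comp_mem_irrChar e.symm χ.2⟩ : irrChar H)
  simp only [Function.comp_apply, map_one] at h2
  rw [h1] at h2
  exact_mod_cast h2.symm

theorem mul_mem_irrChar_prod [Finite G] [Finite H] {χ : G → ℂ} {ψ : H → ℂ} (hχ : χ ∈ irrChar G)
    (hψ : ψ ∈ irrChar H) : (fun x : G × H => χ x.1 * ψ x.2) ∈ irrChar (G × H) := by
  obtain ⟨n, ρ, hρ, rfl⟩ := hχ
  obtain ⟨m, σ, hσ, rfl⟩ := hψ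
  have := isIrreducible_extTensor ρ σ
  have h := character_mem_irrChar (extTensor ρ σ)
  rwa [funext (character_extTensor ρ σ)] at h

/-- Products of characters are separated by orthonormality and exhaust the irreducible characters by
`exists_equiv_extTensor`. -/
theorem exists_irrChar_prod_equiv [Finite G] [Finite H] :
    ∃ f : irrChar G × irrChar H ≃ irrChar (G × H),
      ∀ χ, irrDegree (f χ) = irrDegree χ.1 * irrDegree χ.2 := by
  classical
  have := Fintype.ofFinite G
  have := Fintype.ofFinite H
  let f : irrChar G × irrChar H → irrChar (G × H) := fun χ =>
    ⟨fun x => χ.1.1 x.1 * χ.2.1 x.2, mul_mem_irrChar_prod χ.1.2 χ.2.2⟩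
  have hf : ∀ χ x, (f χ).1 x = χ.1.1 x.1 * χ.2.1 x.2 := fun _ _ => rfl
  have hinj : Function.Injective f := by
    rintro ⟨χ, ψ⟩ ⟨χ', ψ'⟩ h
    have h1 := irrChar_orthonormal (f (χ, ψ)) (f (χ', ψ'))
    rw [if_pos h] at h1
    have h2 : (Nat.card (G × H) : ℂ)⁻¹ *
        ∑ x : G × H, (f (χ, ψ)).1 x * (f (χ', ψ')).1 x⁻¹ =
        ((Nat.card G : ℂ)⁻¹ * ∑ g : G, χ.1 g * χ'.1 g⁻¹) *
        ((Nat.card H : ℂ)⁻¹ * ∑ g : H, ψ.1 g * ψ'.1 g⁻¹) := by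
      rw [mul_mul_mul_comm, Finset.sum_mul_sum, ← Finset.sum_product', Nat.card_prod]
      push_cast
      rw [mul_inv]
      congr 1
      refine Finset.sum_congr (by simp) fun x _ => ?_
      rw [hf, hf, Prod.fst_inv, Prod.snd_inv]
      ring
    -- The left side is `1` and the right side is a product of two Kronecker deltas, so both must be
    -- `1`.
    rw [h1, irrChar_orthonormal, irrChar_orthonormal] at h2
    by_cases h3 : χ = χ'
    · by_cases h4 : ψ = ψ'
      · rw [h3, h4]
      · simp [h4] at h2
    · simp [h3] at h2
  have hsurj : Function.Surjective f := by
    rintro ⟨-, n, τ, hτ, rfl⟩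
    obtain ⟨n, m, ρ, σ, hρ, hσ, ⟨e⟩⟩ := exists_equiv_extTensor τ
    refine ⟨(⟨ρ.character, n, ρ, hρ, rfl⟩, ⟨σ.character, m, σ, hσ, rfl⟩),
      Subtype.ext (funext fun x => ?_)⟩
    exact (character_extTensor ρ σ x).symm.trans (congrFun (char_iso e) x)
  refine ⟨Equiv.ofBijective f ⟨hinj, hsurj⟩, fun χ => ?_⟩
  have h := irrChar_apply_one (f χ)
  rw [hf, Prod.fst_one, Prod.snd_one, irrChar_apply_one, irrChar_apply_one] at h
  exact_mod_cast h.symm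

theorem one_mem_irrChar [Finite G] : (1 : G → ℂ) ∈ irrChar G := by
  have := Fintype.ofFinite G
  have hc : (Representation.trivial ℂ G ℂ).character = 1 := by
    ext g
    simp [character]
  have : (Representation.trivial ℂ G ℂ).IsIrreducible := by
    apply isIrreducible_of_char
    simp [hc]
  rw [← hc]
  exact character_mem_irrChar _

end IrrChar

/-! ### Conjugacy classes of products -/

section ConjClasses

variable {G H : Type*} [Group G] [Group H]

theorem exists_conjClasses_equiv (e : G ≃* H) :
    ∃ f : ConjClasses G ≃ ConjClasses H, ∀ C, Nat.card (f C).carrier = Nat.card C.carrier := by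
  let f : ConjClasses G ≃ ConjClasses H :=
    { toFun := ConjClasses.map e.toMonoidHom
      invFun := ConjClasses.map e.symm.toMonoidHom
      left_inv := by rintro ⟨a⟩; exact congrArg ConjClasses.mk (e.symm_apply_apply a)
      right_inv := by rintro ⟨a⟩; exact congrArg ConjClasses.mk (e.apply_symm_apply a) }
  refine ⟨f, fun C => (Nat.card_congr (e.toEquiv.subtypeEquiv fun a => ?_)).symm⟩
  rw [ConjClasses.mem_carrier_iff_mk_eq, ConjClasses.mem_carrier_iff_mk_eq, ← f.injective.eq_iff]
  rfl

theorem isConj_prod_iff {a b : G × H} : IsConj a b ↔ IsConj a.1 b.1 ∧ IsConj a.2 b.2 := by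
  simp only [isConj_iff, Prod.exists, Prod.ext_iff, Prod.fst_mul, Prod.snd_mul, Prod.fst_inv,
    Prod.snd_inv]
  exact ⟨fun ⟨c, d, h1, h2⟩ => ⟨⟨c, h1⟩, ⟨d, h2⟩⟩, fun ⟨⟨c, h1⟩, ⟨d, h2⟩⟩ => ⟨c, d, h1, h2⟩⟩

theorem exists_conjClasses_prod_equiv :
    ∃ f : ConjClasses G × ConjClasses H ≃ ConjClasses (G × H),
      ∀ C, Nat.card (f C).carrier = Nat.card C.1.carrier * Nat.card C.2.carrier := by
  let f : ConjClasses (G × H) → ConjClasses G × ConjClasses H := fun C =>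
    (ConjClasses.map (MonoidHom.fst G H) C, ConjClasses.map (MonoidHom.snd G H) C)
  have hf : Function.Bijective f := by
    constructor
    · rintro ⟨a⟩ ⟨b⟩ h
      obtain ⟨h1, h2⟩ := Prod.ext_iff.1 h
      exact ConjClasses.mk_eq_mk_iff_isConj.2 (isConj_prod_iff.2
        ⟨ConjClasses.mk_eq_mk_iff_isConj.1 h1, ConjClasses.mk_eq_mk_iff_isConj.1 h2⟩)
    · rintro ⟨⟨a⟩, ⟨b⟩⟩
      exact ⟨ConjClasses.mk (a, b), rfl⟩
  refine ⟨(Equiv.ofBijective f hf).symm, fun C => ?_⟩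
  obtain ⟨C, rfl⟩ := (Equiv.ofBijective f hf).surjective C
  rw [Equiv.symm_apply_apply, ← Nat.card_prod]
  refine Nat.card_congr ((Equiv.subtypeEquivRight fun x => ?_).trans
    (Equiv.Set.prod (ConjClasses.map (MonoidHom.fst G H) C).carrier
      (ConjClasses.map (MonoidHom.snd G H) C).carrier))
  rw [Set.mem_prod, ConjClasses.mem_carrier_iff_mk_eq, ConjClasses.mem_carrier_iff_mk_eq,
    ConjClasses.mem_carrier_iff_mk_eq, ← hf.injective.eq_iff, Prod.ext_iff]
  rfl

theorem card_conjClasses_le [Finite G] : Nat.card (ConjClasses G) ≤ Nat.card G :=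
  Nat.card_le_card_of_surjective _ ConjClasses.mk_surjective

end ConjClasses

/-! ### Uniform treatment of characters and classes -/

namespace ZetaKind

/-- The irreducible characters, respectively the conjugacy classes, of a group. -/
def Class (k : ZetaKind) (G : Type*) [Group G] : Type _ :=
  match k with
  | .irr => irrChar G
  | .cc => ConjClasses G

/-- The degree of an irreducible character, respectively the cardinality of a conjugacy class. -/
noncomputable def weight (k : ZetaKind) {G : Type*} [Group G] (x : k.Class G) : ℕ :=
  match k, x with
  | .irr, x => irrDegree x
  | .cc, x => Nat.card (ConjClasses.carrier x)

variable (k : ZetaKind) {G H : Type*} [Group G] [Group H]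

instance [Finite G] : Finite (k.Class G) :=
  match k with
  | .irr => inferInstanceAs (Finite (irrChar G))
  | .cc => inferInstanceAs (Finite (ConjClasses G))

theorem card_class_le [Finite G] : Nat.card (k.Class G) ≤ Nat.card G :=
  match k with
  | .irr => card_irrChar_le
  | .cc => card_conjClasses_le

theorem weight_pos [Finite G] (x : k.Class G) : 0 < k.weight x := by
  match k, x with
  | .irr, x => exact irrDegree_pos x
  | .cc, x =>
    obtain ⟨a, rfl⟩ := ConjClasses.mk_surjective x
    have : Nonempty (ConjClasses.mk a).carrier := ⟨a, ConjClasses.mem_carrier_mk⟩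
    exact Nat.card_pos

theorem count_eq_card [Finite G] (n : ℕ) :
    k.count G n = Nat.card {x : k.Class G // k.weight x = n} :=
  match k with
  | .irr => irrCount_eq n
  | .cc => rfl

theorem exists_class_equiv [Finite G] (e : G ≃* H) :
    ∃ f : k.Class G ≃ k.Class H, ∀ x, k.weight (f x) = k.weight x :=
  match k with
  | .irr => exists_irrChar_equiv e
  | .cc => exists_conjClasses_equiv e

theorem exists_class_prod_equiv [Finite G] [Finite H] :
    ∃ f : k.Class G × k.Class H ≃ k.Class (G × H),
      ∀ x, k.weight (f x) = k.weight x.1 * k.weight x.2 :=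
  match k with
  | .irr => exists_irrChar_prod_equiv
  | .cc => exists_conjClasses_prod_equiv

instance [Finite G] : Nonempty (k.Class G) :=
  match k with
  | .irr => ⟨(⟨1, one_mem_irrChar⟩ : irrChar G)⟩
  | .cc => ⟨ConjClasses.mk (1 : G)⟩

theorem count_congr [Finite G] (e : G ≃* H) (n : ℕ) : k.count G n = k.count H n := by
  have : Finite H := Finite.of_equiv _ e.toEquiv
  obtain ⟨f, hf⟩ := k.exists_class_equiv e
  rw [count_eq_card, count_eq_card]
  exact Nat.card_congr (f.subtypeEquiv fun x => by rw [hf])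

/-- A sum over the irreducible characters or conjugacy classes, arranged by weight. -/
theorem hasSum_count_mul [Finite G] {E : Type*} [NormedRing E] (g : ℕ → E) :
    HasSum (fun n : ℕ+ => (k.count G n : E) * g n) (∑' x : k.Class G, g (k.weight x)) := by
  have := Fintype.ofFinite (k.Class G)
  let w : k.Class G → ℕ+ := fun x => ⟨k.weight x, k.weight_pos x⟩
  have h1 : HasSum (fun x => g (k.weight x)) (∑' x : k.Class G, g (k.weight x)) :=
    (hasSum_fintype _).summable.hasSum
  -- Regroup the finite sum by the fibres of the weight; the fibre over `n` has `k.count G n`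
  -- elements, on which the summand is constant.
  rw [← (Equiv.sigmaFiberEquiv w).hasSum_iff] at h1
  refine h1.sigma fun n => ?_
  have := Fintype.ofFinite {x // w x = n}
  have h2 := hasSum_fintype fun x : {x // w x = n} => g (k.weight x.1)
  have h3 : ∀ x : {x // w x = n}, g (k.weight x.1) = g n := fun x =>
    congrArg (fun m : ℕ+ => g m) x.2
  have h4 : k.count G n = Fintype.card {x // w x = n} := by
    rw [count_eq_card, ← Nat.card_eq_fintype_card]
    exact Nat.card_congr (Equiv.subtypeEquivRight fun x => (PNat.coe_inj (m := w x)))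
  rw [Finset.sum_congr rfl fun x _ => h3 x, Finset.sum_const, Finset.card_univ, ← h4,
    nsmul_eq_mul] at h2
  exact h2

end ZetaKind

/-! ### Multiplicativity and bounds for the zeta function of a finite group -/

section GroupZeta

variable (k : ZetaKind) {G H : Type*} [Group G] [Group H]

theorem groupZeta_eq_tsum_class [Finite G] (s : ℂ) :
    groupZeta k G s = ∑' x : k.Class G, (k.weight x : ℂ) ^ (-s) :=
  (k.hasSum_count_mul fun n => (n : ℂ) ^ (-s)).tsum_eq

theorem groupZeta_congr [Finite G] (e : G ≃* H) (s : ℂ) : groupZeta k G s = groupZeta k H s :=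
  tsum_congr fun n => by rw [k.count_congr e]

theorem groupZeta_prod [Finite G] [Finite H] (s : ℂ) :
    groupZeta k (G × H) s = groupZeta k G s * groupZeta k H s := by
  have := Fintype.ofFinite (k.Class G)
  have := Fintype.ofFinite (k.Class H)
  obtain ⟨f, hf⟩ := k.exists_class_prod_equiv (G := G) (H := H)
  rw [groupZeta_eq_tsum_class, groupZeta_eq_tsum_class, groupZeta_eq_tsum_class, ← f.tsum_eq,
    tsum_fintype, tsum_fintype, tsum_fintype, Finset.sum_mul_sum, ← Finset.sum_product']
  refine Finset.sum_congr (by simp) fun x _ => ?_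
  rw [hf, Nat.cast_mul, Complex.natCast_mul_natCast_cpow]

/-- There is only one class, and `G × G ≅ G` forces its positive weight to satisfy `w = w * w`, so
`w = 1`. The argument does not distinguish the two kinds. -/
theorem groupZeta_of_subsingleton [Subsingleton G] (s : ℂ) : groupZeta k G s = 1 := by
  have : Unique G := { default := 1, uniq := fun _ => Subsingleton.elim _ _ }
  obtain ⟨f, hf⟩ := k.exists_class_prod_equiv (G := G) (H := G)
  obtain ⟨e, he⟩ := k.exists_class_equiv (MulEquiv.prodUnique : G × G ≃* G)
  have h1 := k.card_class_le (G := G)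
  have : Subsingleton (k.Class G) := by
    rw [← Finite.card_le_one_iff_subsingleton]
    exact h1.trans (Finite.card_le_one_iff_subsingleton.2 inferInstance)
  have : Unique (k.Class G) := Classical.choice (nonempty_unique _)
  have hw : k.weight (default : k.Class G) = 1 := by
    have h2 := hf (default, default)
    rw [← he, Subsingleton.elim (e _) default] at h2
    have h3 := k.weight_pos (default : k.Class G)
    exact Nat.eq_of_mul_eq_mul_left h3 (by rw [← h2, mul_one])
  rw [groupZeta_eq_tsum_class, tsum_eq_single default fun x hx => (hx (Subsingleton.elim _ _)).elim,
    hw]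
  simp

/-- For `Re s > 0`, the series of absolute values of the terms of `ζ^∗_G(s)` is bounded by the
order of `G`. -/
theorem hasSum_norm_count_le [Finite G] {s : ℂ} (hs : 0 < s.re) :
    ∃ a ≤ (Nat.card G : ℝ),
      HasSum (fun n : ℕ+ => ‖(k.count G n : ℂ) * (n : ℂ) ^ (-s)‖) a := by
  have := Fintype.ofFinite (k.Class G)
  have h := k.hasSum_count_mul (G := G) fun n => ‖(n : ℂ) ^ (-s)‖
  refine ⟨_, ?_, by simpa only [norm_mul, Complex.norm_natCast] using h⟩
  rw [tsum_fintype]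
  calc _ ≤ ∑ x : k.Class G, (1 : ℝ) := Finset.sum_le_sum fun x _ => by
        rw [Complex.norm_natCast_cpow_of_pos (k.weight_pos x)]
        refine Real.rpow_le_one_of_one_le_of_nonpos ?_ (by simpa using hs.le)
        exact_mod_cast k.weight_pos x
    _ ≤ Nat.card G := by
        rw [Finset.sum_const, nsmul_one, Finset.card_univ, ← Nat.card_eq_fintype_card]
        exact_mod_cast k.card_class_le

end GroupZeta

/-! ### Euler products over a Dedekind domain -/

section EulerProduct

open IsDedekindDomain Filter Topology

variable {R : Type*} [CommRing R] [IsDedekindDomain R]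

/-- The nonzero ideals all of whose prime divisors lie in `S`. -/
def factoredIdeals (S : Finset (HeightOneSpectrum R)) : Set (Ideal R) :=
  {I | I ≠ ⊥ ∧ ∀ v : HeightOneSpectrum R, v.asIdeal ∣ I → v ∈ S}

theorem factoredIdeals_empty : factoredIdeals (∅ : Finset (HeightOneSpectrum R)) = {⊤} := by
  ext I
  simp only [factoredIdeals, Finset.notMem_empty, imp_false, Set.mem_ofPred_eq,
    Set.mem_singleton_iff]
  constructor
  · rintro ⟨h0, h⟩
    by_contra hI
    obtain ⟨M, hM, hIM⟩ := Ideal.exists_le_maximal I hI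
    have hM0 : M ≠ ⊥ := fun h => h0 (le_bot_iff.1 (h ▸ hIM))
    exact h ⟨M, hM.isPrime, hM0⟩ (Ideal.dvd_iff_le.2 hIM)
  · rintro rfl
    have : Nontrivial R := inferInstance
    exact ⟨top_ne_bot, fun v h => v.isPrime.ne_top (top_le_iff.1 (Ideal.dvd_iff_le.1 h))⟩

theorem isCoprime_pow_of_not_dvd (v : HeightOneSpectrum R) {J : Ideal R}
    (h : ¬ v.asIdeal ∣ J) (N : ℕ) : IsCoprime (v.asIdeal ^ N) J := by
  refine IsCoprime.pow_left (Ideal.isCoprime_iff_sup_eq.2 ?_)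
  refine (v.isMaximal.out).2 _ (left_lt_sup.2 fun hle => h (Ideal.dvd_iff_le.2 hle))

/-- Unique factorisation, one prime at a time: this drives the induction for finite partial
products. -/
theorem exists_factoredIdeals_insert_equiv [DecidableEq (HeightOneSpectrum R)]
    (v : HeightOneSpectrum R) {S : Finset (HeightOneSpectrum R)} (hv : v ∉ S) :
    ∃ e : ℕ × factoredIdeals S ≃ factoredIdeals (insert v S),
      ∀ x, (e x : Ideal R) = v.asIdeal ^ x.1 * x.2 := by
  have hndvd : ∀ J : factoredIdeals S, ¬ v.asIdeal ∣ J := fun J h => hv (J.2.2 v h)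
  have hmem : ∀ x : ℕ × factoredIdeals S,
      v.asIdeal ^ x.1 * (x.2 : Ideal R) ∈ factoredIdeals (insert v S) := by
    rintro ⟨N, J, hJ0, hJ⟩
    refine ⟨mul_ne_zero (pow_ne_zero _ v.ne_bot) hJ0, fun w hw => ?_⟩
    rcases w.prime.dvd_or_dvd hw with h | h
    · have h1 := w.prime.dvd_of_dvd_pow h
      have h2 : v.asIdeal = w.asIdeal :=
        v.isMaximal.eq_of_le w.isPrime.ne_top (Ideal.dvd_iff_le.1 h1)
      rw [← HeightOneSpectrum.ext h2]
      exact Finset.mem_insert_self _ _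
    · exact Finset.mem_insert_of_mem (hJ w h)
  refine ⟨Equiv.ofBijective (fun x => ⟨_, hmem x⟩) ⟨?_, ?_⟩, fun x => rfl⟩
  -- Cancel the smaller power of `v`; a leftover factor `v ^ k` with `k ≠ 0` would divide `J`, which
  -- is prime to `v`.
  · have key : ∀ (N k : ℕ) (J J' : factoredIdeals S),
        v.asIdeal ^ N * (J : Ideal R) = v.asIdeal ^ (N + k) * J' → k = 0 ∧ J = J' := by
      intro N k J J' h
      rw [pow_add, mul_assoc] at h
      have h1 := mul_left_cancel₀ (pow_ne_zero N v.ne_bot) h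
      have hk : k = 0 := by
        by_contra hk
        exact hndvd J (h1 ▸ Dvd.dvd.mul_right (dvd_pow_self _ hk) _)
      subst hk
      exact ⟨rfl, Subtype.ext (by simpa using h1)⟩
    rintro ⟨N, J⟩ ⟨M, J'⟩ h
    have h' : v.asIdeal ^ N * (J : Ideal R) = v.asIdeal ^ M * J' := congrArg Subtype.val h
    rcases le_total N M with hNM | hNM
    · obtain ⟨k, rfl⟩ := Nat.exists_eq_add_of_le hNM
      obtain ⟨rfl, rfl⟩ := key N k J J' h'
      rfl
    · obtain ⟨k, rfl⟩ := Nat.exists_eq_add_of_le hNM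
      obtain ⟨rfl, rfl⟩ := key M k J' J h'.symm
      rfl
  · rintro ⟨I, hI0, hI⟩
    obtain ⟨N, J, hJ, hIJ⟩ := WfDvdMonoid.max_power_factor hI0 v.irreducible
    refine ⟨(N, ⟨J, ?_, fun w hw => ?_⟩), Subtype.ext hIJ.symm⟩
    · rintro rfl
      exact hJ (dvd_zero _)
    · refine (Finset.mem_insert.1 (hI w (hIJ ▸ hw.mul_left _))).resolve_left ?_
      rintro rfl
      exact hJ hw

variable {f : Ideal R → ℂ}

/-- Induction on `S`: adjoining `v` multiplies two absolutely convergent series, and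
multiplicativity applies since `v ^ N` is coprime to every ideal factored over `S`. -/
theorem prod_tsum_eq_tsum_factoredIdeals (hsum : Summable fun I : {I : Ideal R // I ≠ ⊥} => f I)
    (htop : f ⊤ = 1)
    (hmul : ∀ I J : Ideal R, I ≠ ⊥ → J ≠ ⊥ → IsCoprime I J → f (I * J) = f I * f J)
    (S : Finset (HeightOneSpectrum R)) :
    ∏ v ∈ S, ∑' N : ℕ, f (v.asIdeal ^ N) = ∑' I : factoredIdeals S, f I := by
  classical
  induction S using Finset.induction_on with
  | empty =>
    rw [factoredIdeals_empty, Finset.prod_empty, tsum_singleton, htop]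
  | insert v S hv ih =>
    obtain ⟨e, he⟩ := exists_factoredIdeals_insert_equiv v hv
    have h1 : Summable fun N : ℕ => ‖f (v.asIdeal ^ N)‖ := by
      refine (hsum.comp_injective (i := fun N : ℕ =>
        (⟨v.asIdeal ^ N, pow_ne_zero _ v.ne_bot⟩ : {I : Ideal R // I ≠ ⊥})) ?_).norm
      intro N M h
      exact (Ideal.pow_right_strictAnti v.asIdeal v.ne_bot v.isPrime.ne_top).injective
        (congrArg Subtype.val h)
    have h2 : Summable fun J : factoredIdeals S => ‖f J‖ :=
      (hsum.comp_injective (i := fun J : factoredIdeals S =>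
        (⟨J, J.2.1⟩ : {I : Ideal R // I ≠ ⊥}))
        fun _ _ h => Subtype.ext (congrArg (fun x => x.1) h)).norm
    rw [Finset.prod_insert hv, ih, tsum_mul_tsum_of_summable_norm h1 h2, ← e.tsum_eq]
    refine tsum_congr fun x => ?_
    rw [he, hmul _ _ (pow_ne_zero _ v.ne_bot) x.2.2.1
      (isCoprime_pow_of_not_dvd v (fun h => hv (x.2.2.2 v h)) _)]

/-- The Euler product of a multiplicative function on the ideals of a Dedekind domain. -/
theorem hasProd_tsum_pow (hsum : Summable fun I : {I : Ideal R // I ≠ ⊥} => f I)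
    (htop : f ⊤ = 1)
    (hmul : ∀ I J : Ideal R, I ≠ ⊥ → J ≠ ⊥ → IsCoprime I J → f (I * J) = f I * f J) :
    HasProd (fun v : HeightOneSpectrum R => ∑' N : ℕ, f (v.asIdeal ^ N))
      (∑' I : {I : Ideal R // I ≠ ⊥}, f I) := by
  classical
  have key : ∀ S : Finset (HeightOneSpectrum R),
      ∑' I : {I : Ideal R // I ≠ ⊥}, (if I.1 ∈ factoredIdeals S then f I else 0) =
        ∏ v ∈ S, ∑' N : ℕ, f (v.asIdeal ^ N) := by
    intro S
    rw [prod_tsum_eq_tsum_factoredIdeals hsum htop hmul]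
    have h1 : (fun I : Ideal R => if I ∈ factoredIdeals S then f I else 0) =
        (factoredIdeals S).indicator f := rfl
    rw [tsum_subtype (factoredIdeals S) f, ← h1]
    refine tsum_subtype_eq_of_support_subset (s := {I : Ideal R | I ≠ ⊥})
      (f := fun I => if I ∈ factoredIdeals S then f I else 0) fun I hI hI0 => ?_
    exact hI (if_neg fun h => h.1 hI0)
  -- Dominated convergence as `S` grows: a fixed `I` is included as soon as `S` contains its
  -- finitely many prime divisors.
  refine (tendsto_tsum_of_dominated_convergence hsum.norm (fun I => ?_)
    (Eventually.of_forall fun S I => ?_)).congr key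
  · refine tendsto_const_nhds.congr' ?_
    filter_upwards [eventually_ge_atTop (Ideal.finite_factors I.2).toFinset] with S hS
    rw [if_pos ⟨I.2, fun v hv => hS ((Ideal.finite_factors I.2).mem_toFinset.2 hv)⟩]
  · split_ifs
    · exact le_rfl
    · rw [norm_zero]
      exact norm_nonneg _

end EulerProduct

/-! ### Convergence of the Dedekind zeta series -/

section Summability

open Filter Asymptotics

/-- The number of ideals of norm exactly `n` is bounded crudely by the number of norm at most `n`,
which is `O(n)`. This gives comparison with `∑ n^(1 - t)`, hence the threshold `2`, enough because
only some half-plane is needed. -/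
theorem summable_card_quotient_rpow (K : Type*) [Field K] [NumberField K] {t : ℝ} (ht : 2 < t) :
    Summable fun I : {I : Ideal (𝓞 K) // I ≠ ⊥} => (Nat.card (𝓞 K ⧸ I.1) : ℝ) ^ (-t) := by
  let w : {I : Ideal (𝓞 K) // I ≠ ⊥} → ℕ := fun I => Nat.card (𝓞 K ⧸ I.1)
  have hfin : ∀ n, Finite {I // w I = n} := fun n => by
    have := (Ideal.finite_setOfPred_absNorm_eq (S := 𝓞 K) n).to_subtype
    exact Finite.of_injective (β := {I : Ideal (𝓞 K) | Ideal.absNorm I = n})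
      (fun I => ⟨I.1.1, I.2⟩)
      fun I J h => Subtype.ext (Subtype.ext (congrArg (fun x => x.1) h))
  rw [← (Equiv.sigmaFiberEquiv w).summable_iff]
  have hval : ∀ (n : ℕ) (I : {I // w I = n}),
      (Nat.card (𝓞 K ⧸ I.1.1) : ℝ) ^ (-t) = (n : ℝ) ^ (-t) := fun n I =>
    congrArg (fun m : ℕ => (m : ℝ) ^ (-t)) I.2
  refine (summable_sigma_of_nonneg fun x => Real.rpow_nonneg (Nat.cast_nonneg _) _).2
    ⟨fun n => ?_, ?_⟩
  · have := hfin n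
    exact Summable.of_finite
  have hO : (fun n : ℕ => (Nat.card {I : Ideal (𝓞 K) // Ideal.absNorm I ≤ (n : ℝ)} : ℝ))
      =O[atTop] fun n : ℕ => (n : ℝ) := by
    refine isBigO_of_div_tendsto_nhds ?_ _
      ((NumberField.Ideal.tendsto_norm_le_div_atTop K).comp tendsto_natCast_atTop_atTop)
    filter_upwards [eventually_gt_atTop 0] with n hn h
    exact absurd h (by positivity)
  have hO' : (fun n : ℕ => ∑' I : {I // w I = n}, (Nat.card (𝓞 K ⧸ I.1.1) : ℝ) ^ (-t))
      =O[atTop] fun n : ℕ => (n : ℝ) ^ (1 - t) := by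
    have h1 : (fun n : ℕ => (n : ℝ) * (n : ℝ) ^ (-t)) =ᶠ[atTop] fun n => (n : ℝ) ^ (1 - t) := by
      filter_upwards [eventually_gt_atTop 0] with n hn
      rw [sub_eq_add_neg, Real.rpow_add (by positivity), Real.rpow_one]
    refine ((IsBigO.of_bound 1 (Eventually.of_forall fun n => ?_)).trans
      (hO.mul (isBigO_refl (fun n : ℕ => (n : ℝ) ^ (-t)) atTop))).trans_eventuallyEq h1
    rw [tsum_congr (hval n), tsum_const, nsmul_eq_mul, one_mul, norm_mul, norm_mul]
    refine mul_le_mul_of_nonneg_right ?_ (norm_nonneg _)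
    rw [Real.norm_natCast, Real.norm_natCast, Nat.cast_le]
    simp only [Nat.cast_le]
    have : Finite {I : Ideal (𝓞 K) // Ideal.absNorm I ≤ n} :=
      (Ideal.finite_setOfPred_absNorm_le (S := 𝓞 K) n).to_subtype
    exact Nat.card_le_card_of_injective (β := {I : Ideal (𝓞 K) // Ideal.absNorm I ≤ n})
      (fun I => ⟨I.1.1, I.2.le⟩)
      fun I J h => Subtype.ext (Subtype.ext (congrArg (fun x => x.1) h))
  exact summable_of_isBigO_nat (Real.summable_nat_rpow.2 (by linarith)) hO'

end Summability

/-! ### Groups of points: functoriality, products, size -/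

section GroupPoints

variable {R A S T : Type*} [CommRing R] [CommRing A] [HopfAlgebra R A] [CommRing S] [Algebra R S]
  [CommRing T] [Algebra R T]

/-- The homomorphism `𝐆(S) → 𝐆(T)` induced by `S → T`. -/
noncomputable def groupPointsMap (A : Type*) [CommRing A] [HopfAlgebra R A] (φ : S →ₐ[R] T) :
    GroupPoints R A S →* GroupPoints R A T :=
  MonoidHom.mk' (fun f => WithConv.toConv (φ.comp f.ofConv)) fun f g =>
    congrArg WithConv.toConv (AlgHom.comp_convMul_distrib φ f g)

variable (A) in
/-- Isomorphic algebras have isomorphic groups of points. -/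
theorem nonempty_groupPoints_mulEquiv (e : S ≃ₐ[R] T) :
    Nonempty (GroupPoints R A S ≃* GroupPoints R A T) := by
  refine ⟨MulEquiv.ofBijective (groupPointsMap A e.toAlgHom) ⟨fun f g h => ?_, fun f => ?_⟩⟩
  · apply WithConv.ofConv_injective
    ext a
    have h1 := congrArg (fun f => f.ofConv a) h
    exact e.injective h1
  · refine ⟨WithConv.toConv (e.symm.toAlgHom.comp f.ofConv), WithConv.ofConv_injective ?_⟩
    ext a
    exact e.apply_symm_apply _

variable (R A S T) in
/-- The functor of points commutes with products. -/
theorem nonempty_groupPoints_prod_mulEquiv :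
    Nonempty (GroupPoints R A (S × T) ≃* GroupPoints R A S × GroupPoints R A T) := by
  refine ⟨MulEquiv.ofBijective ((groupPointsMap A (AlgHom.fst R S T)).prod
    (groupPointsMap A (AlgHom.snd R S T))) ⟨fun f g h => ?_, fun f => ?_⟩⟩
  · apply WithConv.ofConv_injective
    ext a
    · exact congrArg (fun f => f.1.ofConv a) h
    · exact congrArg (fun f => f.2.ofConv a) h
  · exact ⟨WithConv.toConv (f.1.ofConv.prod f.2.ofConv), rfl⟩

variable (R A) in
/-- For `𝐆` of finite type, the order of `𝐆(S)` is at most a fixed power of the order of `S`. -/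
theorem exists_card_groupPoints_le [Algebra.FiniteType R A] :
    ∃ d : ℕ, ∀ (S : Type*) [CommRing S] [Algebra R S] [Finite S],
      Finite (GroupPoints R A S) ∧ Nat.card (GroupPoints R A S) ≤ Nat.card S ^ d := by
  obtain ⟨s, hs⟩ := ‹Algebra.FiniteType R A›.out
  -- A homomorphism is determined by its values on the finite generating set `s`.
  refine ⟨s.card, fun S _ _ _ => ?_⟩
  let F : GroupPoints R A S → (s → S) := fun f a => f.ofConv a
  have hF : Function.Injective F := fun f g h => by
    apply WithConv.ofConv_injective
    exact AlgHom.ext_of_adjoin_eq_top hs fun a ha => congrFun h ⟨a, ha⟩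
  refine ⟨Finite.of_injective F hF, (Nat.card_le_card_of_injective F hF).trans ?_⟩
  rw [Nat.card_fun]
  simp

end GroupPoints

/-! ### Quotients of the completion versus quotients of `𝓞` -/

section CompletionQuotient

open IsDedekindDomain HeightOneSpectrum WithZero

variable {K : Type*} [Field K] [NumberField K] (v : HeightOneSpectrum (𝓞 K))

/-- A uniformizer taken from `𝓞` generates the maximal ideal, and divisibility in a valuation ring
is comparison of valuations. -/
theorem mem_maximalIdeal_pow_iff (N : ℕ) (x : v.adicCompletionIntegers K) :
    x ∈ IsLocalRing.maximalIdeal (v.adicCompletionIntegers K) ^ N ↔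
      Valued.v (x : v.adicCompletion K) ≤ exp (-(N : ℤ)) := by
  obtain ⟨π, hπ⟩ := v.intValuation_exists_uniformizer
  let p : v.adicCompletionIntegers K := algebraMap (𝓞 K) _ π
  have hp : Valued.v (p : v.adicCompletion K) = exp (-1 : ℤ) := by
    rw [← hπ, ← v.valuation_of_algebraMap (K := K), ← valuedAdicCompletion_eq_valuation']
    rfl
  have hdvd : ∀ N : ℕ, p ^ N ∣ x ↔ Valued.v (x : v.adicCompletion K) ≤ exp (-(N : ℤ)) := by
    intro N
    rw [(adicCompletionIntegers.integers K v).dvd_iff_le]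
    have : exp (-(N : ℤ)) = (exp (-1 : ℤ) : ℤᵐ⁰) ^ N := by
      rw [← exp_nsmul]
      simp
    rw [this, ← hp, map_pow, map_pow]
    rfl
  have hmax : IsLocalRing.maximalIdeal (v.adicCompletionIntegers K) = Ideal.span {p} := by
    have hpu : ¬ IsUnit p := by
      rw [adicCompletionIntegers.isUnit_iff_valued_eq_one, hp]
      exact ne_of_lt (by rw [← exp_zero]; exact exp_lt_exp.2 (by norm_num))
    refine le_antisymm (fun y hy => ?_) ?_
    · rw [Ideal.mem_span_singleton, (adicCompletionIntegers.integers K v).dvd_iff_le]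
      rw [IsLocalRing.mem_maximalIdeal, mem_nonunits_iff,
        adicCompletionIntegers.isUnit_iff_valued_eq_one] at hy
      have h1 : Valued.v (y : v.adicCompletion K) < 1 :=
        lt_of_le_of_ne ((mem_adicCompletionIntegers (𝓞 K) K v).1 y.2) hy
      change Valued.v (y : v.adicCompletion K) ≤ Valued.v (p : v.adicCompletion K)
      rw [hp]
      -- Discreteness of the value group: a value below `exp 0` is at most `exp (-1)`. Zero has no
      -- meaningful logarithm and is treated apart.
      rcases eq_or_ne (Valued.v (y : v.adicCompletion K)) 0 with h0 | h0
      · rw [h0]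
        exact zero_le
      · rw [← exp_log h0] at h1 ⊢
        rw [← exp_zero, exp_lt_exp] at h1
        rw [exp_le_exp]
        omega
    · rw [Ideal.span_singleton_le_iff_mem]
      exact hpu
  rw [hmax, Ideal.span_singleton_pow, Ideal.mem_span_singleton, hdvd]

/-- Two approximations to within `exp (-N)`: density gives `k` in `K` near `x`, which is then
`v`-integral, and a `v`-integral `k` is close to some `a` in `𝓞`. The ultrametric inequality
combines them. -/
theorem algebraMap_completionQuotient_surjective (N : ℕ) :
    Function.Surjective (algebraMap (𝓞 K) (CompletionQuotient K v N)) := by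
  intro y
  obtain ⟨x, rfl⟩ := Ideal.Quotient.mk_surjective y
  obtain ⟨π, hπ⟩ := v.intValuation_exists_uniformizer
  let p : v.adicCompletion K := ((algebraMap (𝓞 K) K (π ^ N) : K) : v.adicCompletion K)
  have hp : Valued.v p = exp (-(N : ℤ)) := by
    rw [valuedAdicCompletion_eq_valuation', valuation_of_algebraMap, map_pow, hπ, ← exp_nsmul]
    simp
  have hp0 : Valued.v.restrict p ≠ 0 := by
    rw [ne_eq, map_eq_zero, ← map_eq_zero (Valued.v : Valuation (v.adicCompletion K) ℤᵐ⁰), hp]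
    exact exp_ne_zero
  have hnhds : {y : v.adicCompletion K | Valued.v (y - x) < Valued.v p} ∈
      nhds (x : v.adicCompletion K) :=
    Valued.mem_nhds.2 ⟨Units.mk0 _ hp0, fun y hy => (Valuation.restrict_lt_iff _).1 hy⟩
  obtain ⟨_, hk, k, rfl⟩ := mem_closure_iff_nhds.1
    (denseRange_algebraMap (K := K) v (x : v.adicCompletion K)) _ hnhds
  replace hk : Valued.v (((k : K) : v.adicCompletion K) - x) < exp (-(N : ℤ)) := hp ▸ hk
  have hN : exp (-(N : ℤ)) ≤ (1 : ℤᵐ⁰) := by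
    rw [← exp_zero, exp_le_exp]
    omega
  have hk1 : v.valuation K k ≤ 1 := by
    rw [← valuedAdicCompletion_eq_valuation', ← sub_add_cancel ((k : K) : v.adicCompletion K) x]
    exact (Valuation.map_add _ _ _).trans
      (max_le (hk.le.trans hN) ((mem_adicCompletionIntegers (𝓞 K) K v).1 x.2))
  obtain ⟨a, ha⟩ := v.exists_valuation_sub_lt_of_integer hk1
    (Units.mk0 (exp (-(N : ℤ))) exp_ne_zero)
  refine ⟨a, Ideal.Quotient.eq.2 ((mem_maximalIdeal_pow_iff v N _).2 ?_)⟩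
  have hak : Valued.v (((algebraMap (𝓞 K) K a : K) : v.adicCompletion K) - (k : K)) <
      exp (-(N : ℤ)) := by
    have h1 := valuedAdicCompletion_eq_valuation' v (algebraMap (𝓞 K) K a - k)
    have h2 : ((algebraMap (𝓞 K) K a - k : K) : v.adicCompletion K) =
        ((algebraMap (𝓞 K) K a : K) : v.adicCompletion K) - (k : K) :=
      map_sub (algebraMap K (v.adicCompletion K)) _ _
    rw [← h2, h1]
    exact ha
  change Valued.v (((algebraMap (𝓞 K) K a : K) : v.adicCompletion K) - x) ≤ _
  rw [← sub_add_sub_cancel _ ((k : K) : v.adicCompletion K)]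
  exact (Valuation.map_add _ _ _).trans (max_le hak.le hk.le)

theorem algebraMap_completionQuotient_eq_zero_iff (N : ℕ) (a : 𝓞 K) :
    algebraMap (𝓞 K) (CompletionQuotient K v N) a = 0 ↔ a ∈ v.asIdeal ^ N := by
  rw [← intValuation_le_pow_iff_mem, ← v.valuation_of_algebraMap (K := K),
    ← valuedAdicCompletion_eq_valuation']
  exact Ideal.Quotient.eq_zero_iff_mem.trans
    (mem_maximalIdeal_pow_iff v N (algebraMap (𝓞 K) (v.adicCompletionIntegers K) a))

/-- `𝓞 / 𝔭ᴺ` is the quotient of the completion at `𝔭` by the `N`-th power of its maximal ideal. -/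
theorem nonempty_quotient_algEquiv_completionQuotient (N : ℕ) :
    Nonempty ((𝓞 K ⧸ v.asIdeal ^ N) ≃ₐ[𝓞 K] CompletionQuotient K v N) := by
  have h : RingHom.ker (Algebra.ofId (𝓞 K) (CompletionQuotient K v N)) = v.asIdeal ^ N :=
    Ideal.ext fun a => algebraMap_completionQuotient_eq_zero_iff v N a
  exact ⟨(Ideal.quotientEquivAlgOfEq (𝓞 K) h.symm).trans
    (Ideal.quotientKerAlgEquivOfSurjective (algebraMap_completionQuotient_surjective v N))⟩

theorem card_quotient_pow (N : ℕ) :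
    Nat.card (𝓞 K ⧸ v.asIdeal ^ N) = completionIndex K v ^ N := by
  have h1 : completionIndex K v = Nat.card (𝓞 K ⧸ v.asIdeal) := by
    obtain ⟨e⟩ := nonempty_quotient_algEquiv_completionQuotient v 1
    rw [pow_one] at e
    have h2 := Nat.card_congr e.toEquiv
    rw [h2, completionIndex, CompletionQuotient, pow_one]
  rw [h1]
  exact map_pow Ideal.absNorm v.asIdeal N

end CompletionQuotient

/-! ### The multiplicative function on ideals and the final assembly -/

section Global

open IsDedekindDomain

variable {K : Type*} [Field K] (A : Type*) [CommRing A] [HopfAlgebra (𝓞 K) A]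

/-- The term of `𝒵^∗_{𝐆(𝓞)}(s₁, s₂)` belonging to the ideal `I`. -/
noncomputable def bivariateTerm (k : ZetaKind) (s₁ s₂ : ℂ) (I : Ideal (𝓞 K)) : ℂ :=
  groupZeta k (GroupPoints (𝓞 K) A (𝓞 K ⧸ I)) s₁ * (Nat.card (𝓞 K ⧸ I) : ℂ) ^ (-s₂)

theorem bivariateTerm_top (k : ZetaKind) (s₁ s₂ : ℂ) :
    bivariateTerm A k s₁ s₂ (⊤ : Ideal (𝓞 K)) = 1 := by
  have : Subsingleton (𝓞 K ⧸ (⊤ : Ideal (𝓞 K))) := Ideal.Quotient.subsingleton_iff.2 rfl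
  have : Subsingleton (GroupPoints (𝓞 K) A (𝓞 K ⧸ (⊤ : Ideal (𝓞 K)))) :=
    ⟨fun f g => WithConv.ofConv_injective (AlgHom.ext fun a => Subsingleton.elim _ _)⟩
  rw [bivariateTerm, groupZeta_of_subsingleton, Nat.card_of_subsingleton 0]
  simp

variable [NumberField K]

theorem finite_quotient_of_ne_bot {I : Ideal (𝓞 K)} (hI : I ≠ ⊥) : Finite (𝓞 K ⧸ I) :=
  Ideal.finiteQuotientOfFreeOfNeBot I hI

theorem card_quotient_pos (I : {I : Ideal (𝓞 K) // I ≠ ⊥}) : 0 < Nat.card (𝓞 K ⧸ I.1) := by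
  have := finite_quotient_of_ne_bot I.2
  exact Nat.card_pos

theorem finite_groupPoints_quotient [Algebra.FiniteType (𝓞 K) A] {I : Ideal (𝓞 K)} (hI : I ≠ ⊥) :
    Finite (GroupPoints (𝓞 K) A (𝓞 K ⧸ I)) := by
  obtain ⟨d, hd⟩ := exists_card_groupPoints_le (𝓞 K) A
  have := finite_quotient_of_ne_bot hI
  exact (hd (𝓞 K ⧸ I)).1

/-- The Chinese remainder isomorphism is `𝓞`-linear, so it induces an isomorphism of groups of
points; both factors of the term are then multiplicative. -/
theorem bivariateTerm_mul [Algebra.FiniteType (𝓞 K) A] (k : ZetaKind) (s₁ s₂ : ℂ)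
    {I J : Ideal (𝓞 K)} (hI : I ≠ ⊥) (hJ : J ≠ ⊥) (h : IsCoprime I J) :
    bivariateTerm A k s₁ s₂ (I * J) = bivariateTerm A k s₁ s₂ I * bivariateTerm A k s₁ s₂ J := by
  let e : (𝓞 K ⧸ I * J) ≃ₐ[𝓞 K] (𝓞 K ⧸ I) × (𝓞 K ⧸ J) :=
    AlgEquiv.ofRingEquiv (f := Ideal.quotientMulEquivQuotientProd I J h) fun _ => rfl
  obtain ⟨f⟩ := nonempty_groupPoints_mulEquiv A e
  obtain ⟨g⟩ := nonempty_groupPoints_prod_mulEquiv (𝓞 K) A (𝓞 K ⧸ I) (𝓞 K ⧸ J)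
  have := finite_groupPoints_quotient A hI
  have := finite_groupPoints_quotient A hJ
  have := finite_groupPoints_quotient A (mul_ne_zero hI hJ)
  rw [bivariateTerm, groupZeta_congr k (f.trans g), groupZeta_prod, Nat.card_congr e.toEquiv,
    Nat.card_prod, Nat.cast_mul, Complex.natCast_mul_natCast_cpow, mul_mul_mul_comm]
  rfl

theorem summable_bivariate [Algebra.FiniteType (𝓞 K) A] (k : ZetaKind) :
    ∃ α : ℝ, ∀ s₁ s₂ : ℂ, 0 < s₁.re → α < s₂.re →
      Summable fun x : {I : Ideal (𝓞 K) // I ≠ ⊥} × ℕ+ =>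
        (k.count (GroupPoints (𝓞 K) A (𝓞 K ⧸ x.1.1)) x.2 : ℂ) * (x.2 : ℂ) ^ (-s₁) *
          (Nat.card (𝓞 K ⧸ x.1.1) : ℂ) ^ (-s₂) := by
  obtain ⟨d, hd⟩ := exists_card_groupPoints_le (𝓞 K) A
  -- The order of `𝐆(𝓞/I)` costs `|𝓞/I|^d`, and the remaining exponent `Re s₂ - d` must exceed `2`.
  refine ⟨d + 2, fun s₁ s₂ h₁ h₂ => Summable.of_norm ?_⟩
  choose a ha has using fun I : {I : Ideal (𝓞 K) // I ≠ ⊥} =>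
    haveI := finite_groupPoints_quotient A I.2
    hasSum_norm_count_le k (G := GroupPoints (𝓞 K) A (𝓞 K ⧸ I.1)) h₁
  have hsum : ∀ I : {I : Ideal (𝓞 K) // I ≠ ⊥}, HasSum (fun n : ℕ+ =>
      ‖(k.count (GroupPoints (𝓞 K) A (𝓞 K ⧸ I.1)) n : ℂ) * (n : ℂ) ^ (-s₁) *
        (Nat.card (𝓞 K ⧸ I.1) : ℂ) ^ (-s₂)‖)
      (a I * ‖(Nat.card (𝓞 K ⧸ I.1) : ℂ) ^ (-s₂)‖) := fun I => by
    simpa only [norm_mul] using (has I).mul_right ‖(Nat.card (𝓞 K ⧸ I.1) : ℂ) ^ (-s₂)‖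
  refine (summable_prod_of_nonneg fun _ => norm_nonneg _).2 ⟨fun I => (hsum I).summable, ?_⟩
  refine Summable.of_nonneg_of_le (fun I => tsum_nonneg fun _ => norm_nonneg _) (fun I => ?_)
    (summable_card_quotient_rpow K (t := s₂.re - d) (by linarith))
  rw [(hsum I).tsum_eq, Complex.norm_natCast_cpow_of_pos (card_quotient_pos I),
    Complex.neg_re]
  have hq : (0 : ℝ) < Nat.card (𝓞 K ⧸ I.1) := by exact_mod_cast card_quotient_pos I
  have h3 : -(s₂.re - d) = d + -s₂.re := by ring
  rw [h3, Real.rpow_add hq, Real.rpow_natCast]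
  refine mul_le_mul_of_nonneg_right ((ha I).trans ?_) (Real.rpow_nonneg hq.le _)
  have := finite_quotient_of_ne_bot I.2
  exact_mod_cast (hd (𝓞 K ⧸ I.1)).2

variable (v : HeightOneSpectrum (𝓞 K))

theorem count_completionQuotient [Algebra.FiniteType (𝓞 K) A] (k : ZetaKind) (N n : ℕ) :
    k.count (GroupPoints (𝓞 K) A (CompletionQuotient K v N)) n =
      k.count (GroupPoints (𝓞 K) A (𝓞 K ⧸ v.asIdeal ^ N)) n := by
  obtain ⟨e⟩ := nonempty_quotient_algEquiv_completionQuotient v N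
  obtain ⟨f⟩ := nonempty_groupPoints_mulEquiv A e
  have := finite_groupPoints_quotient A (I := v.asIdeal ^ N) (pow_ne_zero N v.ne_bot)
  exact (k.count_congr f n).symm

theorem completionIndex_cpow (N : ℕ) (s : ℂ) :
    (completionIndex K v : ℂ) ^ (-(N * s)) = (Nat.card (𝓞 K ⧸ v.asIdeal ^ N) : ℂ) ^ (-s) := by
  rw [card_quotient_pow, Nat.cast_pow, ← Complex.natCast_cpow_natCast_mul]
  simp

theorem localBivariateZeta_eq [Algebra.FiniteType (𝓞 K) A] (k : ZetaKind) (s₁ s₂ : ℂ) :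
    localBivariateZeta K A v k s₁ s₂ = ∑' N : ℕ, bivariateTerm A k s₁ s₂ (v.asIdeal ^ N) := by
  refine tsum_congr fun N => ?_
  rw [bivariateTerm, completionIndex_cpow]
  congr 1
  exact tsum_congr fun n => by rw [count_completionQuotient]

end Global

theorem mainTheorem2 (K : Type*) [Field K] [NumberField K]
    (A : Type*) [CommRing A] [HopfAlgebra (𝓞 K) A] (hG : IsUnipotentGroupScheme (𝓞 K) A)
    (k : ZetaKind) :
    ∃ α₁ α₂ : ℝ, ∀ s₁ s₂ : ℂ, α₁ < s₁.re → α₂ < s₂.re →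
      -- the global series converges absolutely as a double series
      Summable (fun x : {I : Ideal (𝓞 K) // I ≠ ⊥} × ℕ+ =>
        (k.count (GroupPoints (𝓞 K) A (𝓞 K ⧸ x.1.1)) x.2 : ℂ) * (x.2 : ℂ) ^ (-s₁) *
          (Nat.card (𝓞 K ⧸ x.1.1) : ℂ) ^ (-s₂)) ∧
      -- each local series converges absolutely as a double series
      (∀ v : IsDedekindDomain.HeightOneSpectrum (𝓞 K),
        Summable (fun x : ℕ × ℕ+ =>
          (k.count (GroupPoints (𝓞 K) A (CompletionQuotient K v x.1)) x.2 : ℂ) *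
            (x.2 : ℂ) ^ (-s₁) * (completionIndex K v : ℂ) ^ (-(x.1 * s₂)))) ∧
      -- the Euler product converges unconditionally to the global zeta function
      HasProd (fun v : IsDedekindDomain.HeightOneSpectrum (𝓞 K) =>
        localBivariateZeta K A v k s₁ s₂) (globalBivariateZeta K A k s₁ s₂) := by

  have := hG.finiteType
  obtain ⟨α, hα⟩ := summable_bivariate (K := K) A k
  refine ⟨0, α, fun s₁ s₂ h₁ h₂ => ?_⟩
  have hsum := hα s₁ s₂ h₁ h₂
  refine ⟨hsum, fun v => ?_, ?_⟩
  -- The local double series is the part of the global one indexed by the powers of `v`, which are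
  -- pairwise distinct.
  · let i : ℕ × ℕ+ → {I : Ideal (𝓞 K) // I ≠ ⊥} × ℕ+ := fun x =>
      (⟨v.asIdeal ^ x.1, pow_ne_zero _ v.ne_bot⟩, x.2)
    have hi : Function.Injective i := by
      rintro ⟨N, n⟩ ⟨M, m⟩ h
      obtain ⟨h1, h2⟩ := Prod.ext_iff.1 h
      exact Prod.ext ((Ideal.pow_right_strictAnti v.asIdeal v.ne_bot v.isPrime.ne_top).injective
        (congrArg Subtype.val h1)) h2
    refine (hsum.comp_injective hi).congr fun x => ?_
    rw [count_completionQuotient, completionIndex_cpow]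
    rfl
  · have hterm : Summable fun I : {I : Ideal (𝓞 K) // I ≠ ⊥} =>
        bivariateTerm A k s₁ s₂ I.1 := by
      refine hsum.prod.congr fun I => ?_
      rw [bivariateTerm, groupZeta, ← tsum_mul_right]
    have h := hasProd_tsum_pow hterm (bivariateTerm_top A k s₁ s₂)
      fun I J hI hJ hIJ => bivariateTerm_mul A k s₁ s₂ hI hJ hIJ
    rwa [← funext fun v => localBivariateZeta_eq A v k s₁ s₂] at h
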